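/- Let $M$ be a smooth $n$-dimensional manifold and let $V\subset TM$ be a smooth sub-bundle. Put $V^{(0)}=V$ and $V^{(j+1)}=V^{(j)}+[V^{(j)},V^{(j)}]$, and assume that every derived bundle $V^{(j)}$ has constant rank $m_j$. The derived length of $V$ is the smallest $k$ with $V^{(k)}=V^{(k+1)}$. Assume that $V$ is bracket generating (some $V^{(j)}$ equals $TM$) and that its derived length satisfies $k>1$. For a sub-bundle $W\subset TM$ of derived length $K\ge 1$ whose derived bundles have constant ranks $w_j$, put $D_j=w_j-w_{j-1}$ and $D^2_j=D_j-D_{j-1}$; the deceleration (signature) of $W$ is the list of $K$ integers $\mathrm{decel}(W)=\langle -D^2_2,\,-D^2_3,\ldots,-D^2_K,\,D_K\rangle$. Let $G$ be an $r$-dimensional Lie group acting smoothly on $M$ from the right by $\mu:M\times G\to M$, with $(\mu_g)_*V=V$ for all $g\in G$, and let $\Gamma\subset TM$ be spanned pointwise by the infinitesimal generators of the action. Assume that for every $i\ge 0$ the intersection $\Gamma_i=V^{(i)}\cap\Gamma$ has constant rank $r_i$ (the transverse ranks; in particular $\Gamma$ has constant rank). Suppose that the action is $\ell$-transverse for $V$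 for some $1\le \ell\le k-1$, that is, $V^{(\ell)}\cap\Gamma=0$ and $V^{(\ell+1)}\cap\Gamma\neq 0$. Then the sum $\widehat V=V\oplus\Gamma$ is direct, $\widehat V$ is a smooth sub-bundle whose derived bundles have constant ranks, its derived length $\widehat k$ satisfies $1\le\widehat k\le k$, and $$\mathrm{decel}(\widehat V)=\left\langle \nabla^2_2-\Delta^2_2,\ \nabla^2_3-\Delta^2_3,\ \ldots,\ \nabla^2_{\widehat k}-\Delta^2_{\widehat k},\ \Delta_{\widehat k}-\nabla_{\widehat k}\right\rangle ,$$ where $\Delta_i=m_i-m_{i-1}$, $\Delta^2_i=\Delta_i-\Delta_{i-1}$, $\nabla_i=r_i-r_{i-1}$ and $\nabla^2_i=\nabla_i-\nabla_{i-1}$. (For $\widehat k=1$ the list is $\langle\Delta_1-\nabla_1\rangle$.) -/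

import Mathlib

open scoped Manifold ContDiff

noncomputable section

/-- A (not necessarily smooth) distribution on an `n`-dimensional manifold `M`: a linear subspace
of every tangent space. -/
abbrev TangentDistribution (n : ℕ) (M : Type*) [TopologicalSpace M]
    [ChartedSpace (EuclideanSpace ℝ (Fin n)) M] : Type _ :=
  ∀ x : M, Submodule ℝ (TangentSpace (𝓡 n) x)

namespace TangentDistribution

variable {n : ℕ} {M : Type*} [TopologicalSpace M] [ChartedSpace (EuclideanSpace ℝ (Fin n)) M]

/-- The distribution `D` has constant rank `m`. -/
def HasRank (D : TangentDistribution n M) (m : ℕ) : Prop :=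
  ∀ x : M, Module.finrank ℝ (D x) = m

variable [IsManifold (𝓡 n) ∞ M]

/-- `X` restricts to a smooth section of the distribution `D` over the set `U`
(used for open `U`). -/
def IsSectionOn (D : TangentDistribution n M) (U : Set M) (X : ∀ x : M, TangentSpace (𝓡 n) x) : Prop :=
  ContMDiffOn (𝓡 n) (𝓡 n).tangent ∞ (fun x => (⟨x, X x⟩ : TangentBundle (𝓡 n) M)) U ∧
    ∀ x ∈ U, X x ∈ D x

/-- `D` is a smooth sub-bundle of the tangent bundle: it has constant rank and every vector of `D`
is the value of a smooth local section of `D`. -/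
def IsSmoothSubbundle (D : TangentDistribution n M) : Prop :=
  (∃ m : ℕ, D.HasRank m) ∧
    ∀ (x : M), ∀ v ∈ D x, ∃ (U : Set M) (X : ∀ y : M, TangentSpace (𝓡 n) y),
      IsOpen U ∧ x ∈ U ∧ D.IsSectionOn U X ∧ X x = v

/-- The first derived bundle `D + [D, D]`, where `[D, D]` is spanned at each point by the values
of the Lie brackets of smooth local sections of `D`. -/
def derivedOnce (D : TangentDistribution n M) : TangentDistribution n M := fun x =>
  D x ⊔ Submodule.span ℝ
    {v : TangentSpace (𝓡 n) x | ∃ (U : Set M) (X Y : ∀ y : M, TangentSpace (𝓡 n) y),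
      IsOpen U ∧ x ∈ U ∧ D.IsSectionOn U X ∧ D.IsSectionOn U Y ∧
        v = VectorField.mlieBracket (𝓡 n) X Y x}

/-- The derived flag: `D.derived 0 = D` and
`D.derived (j + 1) = D.derived j + [D.derived j, D.derived j]`. -/
def derived (D : TangentDistribution n M) : ℕ → TangentDistribution n M
  | 0 => D
  | j + 1 => (derived D j).derivedOnce

/-- `k` is the derived length of `D`: the smallest `k` at which the derived flag satisfies
`D.derived k = D.derived (k + 1)`. -/
def HasDerivedLength (D : TangentDistribution n M) (k : ℕ) : Prop :=
  IsLeast {j : ℕ | D.derived j = D.derived (j + 1)} k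

/-- Some derived bundle of `D` is the whole tangent bundle. -/
def IsBracketGenerating (D : TangentDistribution n M) : Prop :=
  ∃ j : ℕ, ∀ x : M, D.derived j x = ⊤

/-- The fibrewise intersection of two distributions. -/
def inter (D D' : TangentDistribution n M) : TangentDistribution n M := fun x => D x ⊓ D' x

/-- The fibrewise sum of two distributions. -/
def sum (D D' : TangentDistribution n M) : TangentDistribution n M := fun x => D x ⊔ D' x

end TangentDistribution

/-- First difference `a j - a (j - 1)` of a sequence of ranks (used for `1 ≤ j`). -/
def rankDiff (a : ℕ → ℕ) (j : ℕ) : ℤ := (a j : ℤ) - (a (j - 1) : ℤ)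

/-- Second difference, the difference of consecutive first differences (used for `2 ≤ j`). -/
def rankDiff₂ (a : ℕ → ℕ) (j : ℕ) : ℤ := rankDiff a j - rankDiff a (j - 1)

/-- The list `⟨s 2, s 3, …, s k, t⟩`, with `k` entries when `1 ≤ k`. -/
def signatureList (k : ℕ) (s : ℕ → ℤ) (t : ℤ) : List ℤ :=
  (List.range (k - 1)).map (fun i => s (i + 2)) ++ [t]

namespace TangentDistribution

variable {n : ℕ} {M : Type*} [TopologicalSpace M] [ChartedSpace (EuclideanSpace ℝ (Fin n)) M]
  [IsManifold (𝓡 n) ∞ M]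

/-- The smooth sub-bundle `D`, of derived length `k ≥ 1` and with derived bundles of constant
ranks `m 0, m 1, …`, has deceleration (signature) `L = ⟨-Δ²₂, -Δ²₃, …, -Δ²ₖ, Δₖ⟩`, where
`Δⱼ = m j - m (j - 1)` and `Δ²ⱼ = Δⱼ - Δⱼ₋₁`. -/
def HasDeceleration (D : TangentDistribution n M) (L : List ℤ) : Prop :=
  D.IsSmoothSubbundle ∧
    ∃ (k : ℕ) (m : ℕ → ℕ), 1 ≤ k ∧ D.HasDerivedLength k ∧ (∀ j, (D.derived j).HasRank (m j)) ∧
      L = signatureList k (fun j => -rankDiff₂ m j) (rankDiff m k)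

end TangentDistribution

section Action

variable {n r : ℕ} {M : Type*} [TopologicalSpace M] [ChartedSpace (EuclideanSpace ℝ (Fin n)) M]
  {G : Type*} [TopologicalSpace G] [ChartedSpace (EuclideanSpace ℝ (Fin r)) G] [Group G]

/-- `μ` is a smooth right action of the Lie group `G` (of dimension `r`) on the manifold `M`
(of dimension `n`). -/
structure IsSmoothRightAction (n r : ℕ) {M : Type*} [TopologicalSpace M]
    [ChartedSpace (EuclideanSpace ℝ (Fin n)) M] {G : Type*} [TopologicalSpace G]
    [ChartedSpace (EuclideanSpace ℝ (Fin r)) G] [Group G] (μ : M → G → M) : Prop where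
  smooth : ContMDiff ((𝓡 n).prod (𝓡 r)) (𝓡 n) ∞ (fun p : M × G => μ p.1 p.2)
  act_one : ∀ x : M, μ x 1 = x
  act_mul : ∀ (x : M) (g h : G), μ (μ x g) h = μ x (g * h)

/-- The infinitesimal generator of the action `μ` belonging to the element `ξ` of the Lie algebra
`T₁G`: the vector field `x ↦ d/dt|₀ μ x (g t)` for any curve `g` with `g 0 = 1` and `g' 0 = ξ`.
The value lies in the tangent space at `μ x 1`, which is `x`. -/
def infinitesimalGenerator (n r : ℕ) {M : Type*} [TopologicalSpace M]
    [ChartedSpace (EuclideanSpace ℝ (Fin n)) M] {G : Type*} [TopologicalSpace G]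
    [ChartedSpace (EuclideanSpace ℝ (Fin r)) G] [Group G] (μ : M → G → M)
    (ξ : TangentSpace (𝓡 r) (1 : G)) (x : M) : TangentSpace (𝓡 n) x :=
  (mfderiv (𝓡 r) (𝓡 n) (μ x) (1 : G) ξ : TangentSpace (𝓡 n) (μ x 1))

/-- The distribution spanned at each point by the infinitesimal generators of the action. -/
def generatorBundle (n r : ℕ) {M : Type*} [TopologicalSpace M]
    [ChartedSpace (EuclideanSpace ℝ (Fin n)) M] {G : Type*} [TopologicalSpace G]
    [ChartedSpace (EuclideanSpace ℝ (Fin r)) G] [Group G] (μ : M → G → M) : TangentDistribution n M :=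
  fun x => Submodule.span ℝ
    (Set.range fun ξ : TangentSpace (𝓡 r) (1 : G) => infinitesimalGenerator n r μ ξ x)

/-- `V` is invariant under the action: the differential of each `μ_g` maps `V x` onto
`V (μ x g)`. -/
def IsInvariantUnder (V : TangentDistribution n M) (μ : M → G → M) : Prop :=
  ∀ (g : G) (x : M),
    (V x).map (mfderiv (𝓡 n) (𝓡 n) (fun y => μ y g) x).toLinearMap = V (μ x g)

/-- For distributions `V` and `Γ`, with `Γ` spanned by infinitesimal generators: the action is
`ℓ`-transverse for `V`. -/
def IsTransverse [IsManifold (𝓡 n) ∞ M] (V Γ : TangentDistribution n M) (ℓ : ℕ) : Prop :=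
  (∀ x : M, (V.derived ℓ).inter Γ x = ⊥) ∧ ¬ ∀ x : M, (V.derived (ℓ + 1)).inter Γ x = ⊥

end Action

end

/-! The heart of the matter is that adjoining Γ commutes with derivation: the `j`-th derived bundle
of V + Γ is V^(j) + Γ. Granting this, its rank is m_j + rank Γ - r_j, and in the first and second
differences the constant rank Γ cancels, which gives the stated signature.

For the commutation, each V^(j) is invariant because pullback by a diffeomorphism respects brackets,
and Γ is invariant because conjugation acts on the Lie algebra. Invariance under G implies
infinitesimal invariance: if W is invariant, the bracket of a generator with a section of W lies in
W (`mlieBracket_infinitesimalGenerator_mem`). With W = V^(j) and W = Γ this puts every bracket of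
generating sections of V^(j) + Γ into V^(j+1) + Γ. Arbitrary sections reduce to generating ones by
the Leibniz rule, once coefficients in a frame are smooth; constancy of the rank of V^(j) + Γ is
what provides them (`mlieBracket_mem_of_spanning`).

The new flag is stationary at `k` because the flag of V is. It is not stationary at 0:
transversality with `ℓ ≥ 1` gives r_0 = r_1 = 0, while m_0 ≠ m_1. -/

open Filter Topology VectorField

/-! ### Infinitesimal invariance in a vector space -/

/-- If a curve stays in a subspace near a point, so does its derivative there. -/
theorem HasDerivAt.mem_of_eventually_mem {E : Type*} [NormedAddCommGroup E] [NormedSpace ℝ E]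
    [FiniteDimensional ℝ E] {c : ℝ → E} {d : E} {t : ℝ} (hc : HasDerivAt c d t)
    (S : Submodule ℝ E) (hS : ∀ᶠ s in 𝓝 t, c s ∈ S) : d ∈ S := by
  obtain ⟨q, hq⟩ := S.exists_isCompl
  -- A continuous linear map with kernel exactly `S`; composing with it turns membership into
  -- vanishing.
  let p : E →L[ℝ] q := LinearMap.toContinuousLinearMap (q.projectionOnto S hq.symm)
  have hp : ∀ v, p v = 0 ↔ v ∈ S := fun v => Submodule.projectionOnto_apply_eq_zero_iff hq.symm
  have h1 : HasDerivAt (fun s => p (c s)) (p d) t := p.hasFDerivAt.comp_hasDerivAt t hc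
  have h2 : HasDerivAt (fun s => p (c s)) 0 t :=
    (hasDerivAt_const t (0 : q)).congr_of_eventuallyEq (hS.mono fun s hs => (hp _).2 hs)
  exact (hp d).1 (h1.unique h2)

/-- If a smooth family `F (t, ·)` of local diffeomorphisms starting at the identity carries a
subspace `S` at `u₀` to subspaces containing the values of `X`, then the Lie bracket of the
initial velocity field of the family with `X` lies in `S` at `u₀`. -/
theorem VectorField.lieBracket_mem_of_eventually_mem_map {E : Type*} [NormedAddCommGroup E]
    [NormedSpace ℝ E] [FiniteDimensional ℝ E] {F : ℝ × E → E} {u₀ : E}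
    (hF : ContDiffAt ℝ 2 F (0, u₀)) (hF0 : ∀ᶠ u in 𝓝 u₀, F (0, u) = u) {Z X : E → E}
    (hZ : ∀ᶠ u in 𝓝 u₀, Z u = fderiv ℝ F (0, u) (1, 0)) (hX : DifferentiableAt ℝ X u₀)
    (S : Submodule ℝ E)
    (hS : ∀ᶠ t in 𝓝 (0 : ℝ), ∃ w ∈ S, X (F (t, u₀)) = fderiv ℝ F (t, u₀) (0, w)) :
    VectorField.lieBracket ℝ Z X u₀ ∈ S := by
  have hFd : DifferentiableAt ℝ F (0, u₀) := hF.differentiableAt (by norm_num)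
  have hFu : F (0, u₀) = u₀ := hF0.self_of_nhds
  have hDF : DifferentiableAt ℝ (fderiv ℝ F) (0, u₀) :=
    (hF.fderiv_right (m := 1) (by norm_num)).differentiableAt (by norm_num)
  have hsymm : IsSymmSndFDerivAt ℝ F (0, u₀) := hF.isSymmSndFDerivAt (by simp)
  have hcurve : HasDerivAt (fun t : ℝ => ((t, u₀) : ℝ × E)) (1, 0) 0 :=
    (hasDerivAt_id (0 : ℝ)).prodMk (hasDerivAt_const (0 : ℝ) u₀)
  have hslice : HasFDerivAt (fun u : E => ((0, u) : ℝ × E)) (ContinuousLinearMap.inr ℝ ℝ E) u₀ :=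
    hasFDerivAt_prodMk_right 0 u₀
  -- `A t` is the differential of `F (t, ·)` at `u₀`, so `A 0` is the identity and `A t` stays
  -- invertible for small `t`.
  let A : ℝ → E →L[ℝ] E := fun t => (fderiv ℝ F (t, u₀)).comp (ContinuousLinearMap.inr ℝ ℝ E)
  have hA0 : A 0 = ContinuousLinearMap.id ℝ E := by
    have h1 : HasFDerivAt (fun u => F (0, u)) (A 0) u₀ :=
      HasFDerivAt.comp (f := fun u : E => ((0, u) : ℝ × E)) u₀ hFd.hasFDerivAt hslice
    exact h1.unique ((hasFDerivAt_id u₀).congr_of_eventuallyEq hF0)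
  have hA : HasDerivAt A ((fderiv ℝ (fderiv ℝ F) (0, u₀) (1, 0)).comp
      (ContinuousLinearMap.inr ℝ ℝ E)) 0 := by
    have h1 : HasDerivAt (fun t : ℝ => fderiv ℝ F (t, u₀)) (fderiv ℝ (fderiv ℝ F) (0, u₀) (1, 0)) 0 :=
      HasFDerivAt.comp_hasDerivAt (f := fun t : ℝ => ((t, u₀) : ℝ × E)) 0 hDF.hasFDerivAt hcurve
    have h2 := h1.clm_comp (hasDerivAt_const (0 : ℝ) (ContinuousLinearMap.inr ℝ ℝ E))
    simpa using h2
  have hinv0 : (A 0).IsInvertible := by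
    rw [hA0]; exact ⟨ContinuousLinearEquiv.refl ℝ E, rfl⟩
  have hXF : HasDerivAt (fun t : ℝ => X (F (t, u₀))) (fderiv ℝ X u₀ (fderiv ℝ F (0, u₀) (1, 0))) 0 := by
    have h1 : HasDerivAt (fun t : ℝ => F (t, u₀)) (fderiv ℝ F (0, u₀) (1, 0)) 0 :=
      HasFDerivAt.comp_hasDerivAt (f := fun t : ℝ => ((t, u₀) : ℝ × E)) 0 hFd.hasFDerivAt hcurve
    refine HasFDerivAt.comp_hasDerivAt (f := fun t : ℝ => F (t, u₀)) 0 ?_ h1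
    rw [hFu]; exact hX.hasFDerivAt
  -- The pullback of `X` to `u₀` along the family. It lies in `S` by `hS`, and its derivative at 0
  -- will be the bracket.
  let c : ℝ → E := fun t => (A t).inverse (X (F (t, u₀)))
  have hc : DifferentiableAt ℝ c 0 := by
    refine DifferentiableAt.clm_apply ?_ hXF.differentiableAt
    exact DifferentiableAt.comp (0 : ℝ) ((hinv0.contDiffAt_map_inverse (n := 1)).differentiableAt
      (by norm_num)) hA.differentiableAt
  have hinv : ∀ᶠ t in 𝓝 (0 : ℝ), (A t).IsInvertible := by
    obtain ⟨e, he⟩ := hinv0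
    have := hA.continuousAt.eventually (he ▸ ContinuousLinearEquiv.nhds e)
    exact this
  have hAc : ∀ᶠ t in 𝓝 (0 : ℝ), A t (c t) = X (F (t, u₀)) :=
    hinv.mono fun t ht => ht.self_apply_inverse _
  have hcS : ∀ᶠ t in 𝓝 (0 : ℝ), c t ∈ S := by
    filter_upwards [hinv, hS] with t ht ⟨w, hw, hXw⟩
    have : c t = w := by
      change (A t).inverse (X (F (t, u₀))) = w
      rw [hXw]
      exact ht.inverse_apply_eq.2 rfl
    rwa [this]
  have hc0 : c 0 = X u₀ := by
    have := hAc.self_of_nhds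
    rwa [hA0, hFu] at this
  have hmem := hc.hasDerivAt.mem_of_eventually_mem S hcS
  -- Differentiating `A t (c t) = X (F (t, u₀))` at 0 gives A'(0) X + c'(0) = DX(Z). Symmetry of the
  -- second derivative identifies A'(0) X with DZ(X).
  have hprod := (hA.clm_apply hc.hasDerivAt).unique (hXF.congr_of_eventuallyEq hAc)
  have hZ' : fderiv ℝ Z u₀ (X u₀) = fderiv ℝ (fderiv ℝ F) (0, u₀) (1, 0) (0, X u₀) := by
    have h1 : HasFDerivAt (fun u => fderiv ℝ F (0, u) (1, 0)) _ u₀ :=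
      (HasFDerivAt.comp (f := fun u : E => ((0, u) : ℝ × E)) u₀ hDF.hasFDerivAt hslice).clm_apply
        (hasFDerivAt_const ((1, 0) : ℝ × E) u₀)
    rw [(h1.congr_of_eventuallyEq hZ).fderiv, ← hsymm.eq]
    simp
  have : VectorField.lieBracket ℝ Z X u₀ = deriv c 0 := by
    rw [VectorField.lieBracket, hZ', hZ.self_of_nhds, ← hprod, hA0, hc0]
    simp
  rwa [this]

/-! ### Smooth frames and the Leibniz rule -/

/-- Coefficients with respect to a pointwise independent smooth family are smooth. -/
theorem exists_contMDiffAt_coeff {n : ℕ} {M : Type*} [TopologicalSpace M]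
    [ChartedSpace (EuclideanSpace ℝ (Fin n)) M] {F : Type*} [NormedAddCommGroup F]
    [NormedSpace ℝ F] [FiniteDimensional ℝ F] {ι : Type*} [Fintype ι] {φ : ι → M → F} {ψ : M → F}
    {x : M} (hφ : ∀ i, ContMDiffAt (𝓡 n) 𝓘(ℝ, F) ∞ (φ i) x)
    (hψ : ContMDiffAt (𝓡 n) 𝓘(ℝ, F) ∞ ψ x) (hli : LinearIndependent ℝ fun i => φ i x)
    (hspan : ∀ᶠ y in 𝓝 x, ψ y ∈ Submodule.span ℝ (Set.range fun i => φ i y)) :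
    ∃ f : ι → M → ℝ, (∀ i, ContMDiffAt (𝓡 n) 𝓘(ℝ) ∞ (f i) x) ∧
      ∀ᶠ y in 𝓝 x, ψ y = ∑ i, f i y • φ i y := by
  let comb : (ι → F) → (ι → ℝ) →L[ℝ] F := fun v =>
    ∑ i, (ContinuousLinearMap.proj (R := ℝ) (φ := fun _ : ι => ℝ) i).smulRight (v i)
  have hcomb : ∀ v a, comb v a = ∑ i, a i • v i := fun v a => by simp [comb]
  obtain ⟨p₀, hp₀⟩ := LinearMap.exists_leftInverse_of_injective
    (comb fun i => φ i x).toLinearMap (by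
      rw [LinearMap.ker_eq_bot']
      intro a ha
      have := Fintype.linearIndependent_iff.1 hli a (by simpa [hcomb] using ha)
      exact funext this)
  let p : F →L[ℝ] (ι → ℝ) := LinearMap.toContinuousLinearMap p₀
  -- `p` inverts the combination map on the left at `x` only. `L y` measures the failure at `y`;
  -- being the identity at `x`, it is invertible nearby, and the coefficients are `(L y)⁻¹ (p (ψ
  -- y))`.
  let L : M → (ι → ℝ) →L[ℝ] (ι → ℝ) := fun y => p.comp (comb fun i => φ i y)
  have hLx : L x = ContinuousLinearMap.id ℝ _ := by
    ext1 a
    exact LinearMap.congr_fun hp₀ a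
  have hL : ContMDiffAt (𝓡 n) 𝓘(ℝ, (ι → ℝ) →L[ℝ] (ι → ℝ)) ∞ L x := by
    have hd : ContDiff ℝ ∞ fun v : ι → F => p.comp (comb v) := by
      simp only [comb]
      fun_prop
    exact (hd.contDiffAt (x := fun i => φ i x)).comp_contMDiffAt (f := fun y i => φ i y)
      ((contMDiffAt_pi_space).2 hφ)
  have hinvx : (L x).IsInvertible := by
    rw [hLx]; exact ⟨ContinuousLinearEquiv.refl ℝ _, rfl⟩
  have hinv : ∀ᶠ y in 𝓝 x, (L y).IsInvertible := by
    obtain ⟨e, he⟩ := hinvx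
    exact hL.continuousAt.eventually (he ▸ ContinuousLinearEquiv.nhds e)
  have hf : ContMDiffAt (𝓡 n) 𝓘(ℝ, ι → ℝ) ∞ (fun y => (L y).inverse (p (ψ y))) x := by
    have h1 : ContMDiffAt (𝓡 n) 𝓘(ℝ, (ι → ℝ) →L[ℝ] (ι → ℝ)) ∞ (fun y => (L y).inverse) x :=
      hinvx.contDiffAt_map_inverse.comp_contMDiffAt hL
    have h2 : ContMDiffAt (𝓡 n) 𝓘(ℝ, ι → ℝ) ∞ (fun y => p (ψ y)) x :=
      p.contDiff.contDiffAt.comp_contMDiffAt hψ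
    exact h1.clm_apply h2
  refine ⟨fun i y => (L y).inverse (p (ψ y)) i, fun i => (contMDiffAt_pi_space).1 hf i, ?_⟩
  filter_upwards [hinv, hspan] with y hy hys
  obtain ⟨a, ha⟩ := (Submodule.mem_span_range_iff_exists_fun ℝ).1 hys
  have : (L y).inverse (p (ψ y)) = a := by
    rw [hy.inverse_apply_eq, ← ha]
    simp [L, hcomb]
  rw [this, ha]

namespace TangentDistribution

variable {n : ℕ} {M : Type*} [TopologicalSpace M] [ChartedSpace (EuclideanSpace ℝ (Fin n)) M]
  [IsManifold (𝓡 n) ∞ M]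

/-- Independence is an open condition, so near `x` the `E i` remain independent, and by the rank
count they span `D`. The vector-valued lemma then applies in a trivialization. -/
theorem exists_frame_coeff {ι : Type*} [Fintype ι] {D : TangentDistribution n M} {d : ℕ}
    (hD : D.HasRank d) (hι : Fintype.card ι = d) {x : M}
    {E : ι → ∀ y : M, TangentSpace (𝓡 n) y} {X : ∀ y : M, TangentSpace (𝓡 n) y}
    (hE : ∀ i, ContMDiffAt (𝓡 n) (𝓡 n).tangent ∞
      (fun y => (⟨y, E i y⟩ : TangentBundle (𝓡 n) M)) x)
    (hED : ∀ i, ∀ᶠ y in 𝓝 x, E i y ∈ D y)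
    (hX : ContMDiffAt (𝓡 n) (𝓡 n).tangent ∞ (fun y => (⟨y, X y⟩ : TangentBundle (𝓡 n) M)) x)
    (hXD : ∀ᶠ y in 𝓝 x, X y ∈ D y) (hli : LinearIndependent ℝ fun i => E i x) :
    ∃ f : ι → M → ℝ, (∀ i, ContMDiffAt (𝓡 n) 𝓘(ℝ) ∞ (f i) x) ∧
      ∀ᶠ y in 𝓝 x, X y = ∑ i, f i y • E i y := by
  let e := trivializationAt (EuclideanSpace ℝ (Fin n)) (TangentSpace (𝓡 n)) x
  have hxe : x ∈ e.baseSet := FiberBundle.mem_baseSet_trivializationAt' x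
  have hφ : ∀ i, ContMDiffAt (𝓡 n) 𝓘(ℝ, EuclideanSpace ℝ (Fin n)) ∞
      (fun y => (e (⟨y, E i y⟩ : TangentBundle (𝓡 n) M)).2) x :=
    fun i => (Bundle.contMDiffAt_section x).1 (hE i)
  have hψ : ContMDiffAt (𝓡 n) 𝓘(ℝ, EuclideanSpace ℝ (Fin n)) ∞
      (fun y => (e (⟨y, X y⟩ : TangentBundle (𝓡 n) M)).2) x := (Bundle.contMDiffAt_section x).1 hX
  have hli' : LinearIndependent ℝ fun i => (e (⟨x, E i x⟩ : TangentBundle (𝓡 n) M)).2 :=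
    hli.map' (e.linearEquivAt ℝ x hxe).toLinearMap (LinearEquiv.ker _)
  have hev : ∀ᶠ y in 𝓝 x, LinearIndependent ℝ
      fun i => (e (⟨y, E i y⟩ : TangentBundle (𝓡 n) M)).2 := by
    have hc : ContinuousAt (fun y i => (e (⟨y, E i y⟩ : TangentBundle (𝓡 n) M)).2) x :=
      continuousAt_pi.2 fun i => (hφ i).continuousAt
    exact hc.eventually (isOpen_setOfPred_linearIndependent.mem_nhds hli')
  have hbase : ∀ᶠ y in 𝓝 x, y ∈ e.baseSet := e.open_baseSet.mem_nhds hxe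
  have hspan : ∀ᶠ y in 𝓝 x, (e (⟨y, X y⟩ : TangentBundle (𝓡 n) M)).2 ∈
      Submodule.span ℝ (Set.range fun i => (e (⟨y, E i y⟩ : TangentBundle (𝓡 n) M)).2) := by
    filter_upwards [hev, hbase, eventually_all.2 hED, hXD] with y hy hye hEy hXy
    have hly : LinearIndependent ℝ fun i => E i y :=
      LinearIndependent.of_comp (e.linearEquivAt ℝ y hye).toLinearMap hy
    have hle : Submodule.span ℝ (Set.range fun i => E i y) ≤ D y :=
      Submodule.span_le.2 (by rintro _ ⟨i, rfl⟩; exact hEy i)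
    have : FiniteDimensional ℝ (TangentSpace (𝓡 n) y) :=
      inferInstanceAs (FiniteDimensional ℝ (EuclideanSpace ℝ (Fin n)))
    have heq : Submodule.span ℝ (Set.range fun i => E i y) = D y :=
      Submodule.eq_of_le_of_finrank_eq hle (by
        rw [finrank_span_eq_card hly, hι, hD y])
    rw [← heq] at hXy
    have := Submodule.mem_map_of_mem (f := (e.linearEquivAt ℝ y hye).toLinearMap) hXy
    rw [Submodule.map_span, ← Set.range_comp] at this
    exact this
  obtain ⟨f, hf, hfX⟩ := exists_contMDiffAt_coeff hφ hψ hli' hspan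
  refine ⟨f, hf, ?_⟩
  filter_upwards [hfX, hbase] with y hy hye
  apply (e.linearEquivAt ℝ y hye).injective
  rw [map_sum]
  simp only [map_smul]
  exact hy

/-- By Leibniz, [fE, Y] = f[E, Y] - (Yf)E, and both terms lie in `S`. -/
theorem mlieBracket_mem_of_frame_left {ι : Type*} {x : M}
    {E : ι → ∀ y : M, TangentSpace (𝓡 n) y} {f : ι → M → ℝ} {Y : ∀ y : M, TangentSpace (𝓡 n) y}
    (hE : ∀ i, ContMDiffAt (𝓡 n) (𝓡 n).tangent ∞
      (fun y => (⟨y, E i y⟩ : TangentBundle (𝓡 n) M)) x)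
    (hf : ∀ i, ContMDiffAt (𝓡 n) 𝓘(ℝ) ∞ (f i) x) (S : Submodule ℝ (TangentSpace (𝓡 n) x))
    (hES : ∀ i, E i x ∈ S) (hbr : ∀ i, mlieBracket (𝓡 n) (E i) Y x ∈ S) (s : Finset ι) :
    mlieBracket (𝓡 n) (fun y => ∑ i ∈ s, f i y • E i y) Y x ∈ S := by
  classical

  induction s using Finset.induction_on with
  | empty =>
    have : (fun y => ∑ i ∈ (∅ : Finset ι), f i y • E i y) = (0 : ∀ y : M, TangentSpace (𝓡 n) y) :=
      funext fun y => Finset.sum_empty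
    rw [this, mlieBracket_zero_left]
    exact S.zero_mem
  | insert i s hi ih =>
    have h1 : ∀ j, ContMDiffAt (𝓡 n) (𝓡 n).tangent ∞
        (fun y => (⟨y, (f j • E j) y⟩ : TangentBundle (𝓡 n) M)) x :=
      fun j => (hf j).smul_section (hE j)
    have h2 : ContMDiffAt (𝓡 n) (𝓡 n).tangent ∞
        (fun y => (⟨y, ∑ j ∈ s, f j y • E j y⟩ : TangentBundle (𝓡 n) M)) x :=
      ContMDiffAt.sum_section (s := s) fun j _ => h1 j
    have : (fun y => ∑ j ∈ insert i s, f j y • E j y) =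
        f i • E i + (fun y => ∑ j ∈ s, f j y • E j y : ∀ y : M, TangentSpace (𝓡 n) y) :=
      funext fun y => Finset.sum_insert hi
    rw [this, mlieBracket_add_left ((h1 i).mdifferentiableAt (by simp))
      (h2.mdifferentiableAt (by simp)), mlieBracket_smul_left ((hf i).mdifferentiableAt (by simp))
      ((hE i).mdifferentiableAt (by simp))]
    exact S.add_mem (S.add_mem (S.smul_mem _ (hES i)) (S.smul_mem _ (hbr i))) ih

/-- If smooth sections from a family span the distribution `D` of constant rank at `x`, then
brackets of sections of `D` at `x` lie in any subspace that contains `D x` and the brackets of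
members of the family. -/
theorem mlieBracket_mem_of_spanning {D : TangentDistribution n M} {d : ℕ} (hD : D.HasRank d) {x : M}
    (𝓔 : Set (∀ y : M, TangentSpace (𝓡 n) y))
    (h𝓔 : ∀ E ∈ 𝓔, ContMDiffAt (𝓡 n) (𝓡 n).tangent ∞
      (fun y => (⟨y, E y⟩ : TangentBundle (𝓡 n) M)) x)
    (h𝓔D : ∀ E ∈ 𝓔, ∀ᶠ y in 𝓝 x, E y ∈ D y)
    (hspan : D x ≤ Submodule.span ℝ ((fun E => E x) '' 𝓔)) (S : Submodule ℝ (TangentSpace (𝓡 n) x))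
    (hDS : D x ≤ S) (hbr : ∀ E ∈ 𝓔, ∀ E' ∈ 𝓔, mlieBracket (𝓡 n) E E' x ∈ S)
    {X Y : ∀ y : M, TangentSpace (𝓡 n) y}
    (hX : ContMDiffAt (𝓡 n) (𝓡 n).tangent ∞ (fun y => (⟨y, X y⟩ : TangentBundle (𝓡 n) M)) x)
    (hXD : ∀ᶠ y in 𝓝 x, X y ∈ D y)
    (hY : ContMDiffAt (𝓡 n) (𝓡 n).tangent ∞ (fun y => (⟨y, Y y⟩ : TangentBundle (𝓡 n) M)) x)
    (hYD : ∀ᶠ y in 𝓝 x, Y y ∈ D y) : mlieBracket (𝓡 n) X Y x ∈ S := by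
  have : FiniteDimensional ℝ (TangentSpace (𝓡 n) x) :=
    inferInstanceAs (FiniteDimensional ℝ (EuclideanSpace ℝ (Fin n)))
  -- A basis of `D x` chosen among the values of the family; the corresponding members form a local
  -- frame.
  obtain ⟨b, hb, hbspan, hbli⟩ := exists_linearIndependent ℝ ((fun E => E x) '' 𝓔)
  have hDspan : Submodule.span ℝ ((fun E => E x) '' 𝓔) = D x :=
    le_antisymm (Submodule.span_le.2 (by
      rintro _ ⟨E, hE, rfl⟩; exact (h𝓔D E hE).self_of_nhds)) hspan
  choose E hE𝓔 hEx using fun v : b => hb v.2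
  have : Fintype b := hbli.setFinite.fintype
  have hcard : Fintype.card b = d := by
    rw [← finrank_span_eq_card hbli, Subtype.range_coe, hbspan, hDspan, hD x]
  have hli : LinearIndependent ℝ fun v : b => E v x := by
    have : (fun v : b => E v x) = ((↑) : b → TangentSpace (𝓡 n) x) := funext hEx
    rw [this]; exact hbli
  have hEs := fun v => h𝓔 _ (hE𝓔 v)
  have hEDs := fun v => h𝓔D _ (hE𝓔 v)
  have hES : ∀ v, E v x ∈ S := fun v => hDS (hEDs v).self_of_nhds
  obtain ⟨f, hf, hfX⟩ := exists_frame_coeff hD hcard hEs hEDs hX hXD hli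
  obtain ⟨g, hg, hgY⟩ := exists_frame_coeff hD hcard hEs hEDs hY hYD hli
  rw [Filter.EventuallyEq.mlieBracket_vectorField_eq hfX hgY]
  refine mlieBracket_mem_of_frame_left hEs hf S hES (fun v => ?_) _
  rw [mlieBracket_swap_apply]
  refine S.neg_mem (mlieBracket_mem_of_frame_left hEs hg S hES (fun w => ?_) _)
  exact hbr _ (hE𝓔 w) _ (hE𝓔 v)

end TangentDistribution

/-! ### Local sections and the derived flag -/

theorem isManifold_minSmoothness_two (n : ℕ) (M : Type*) [TopologicalSpace M]
    [ChartedSpace (EuclideanSpace ℝ (Fin n)) M] [IsManifold (𝓡 n) ∞ M] :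
    IsManifold (𝓡 n) (minSmoothness ℝ 2) M :=
  IsManifold.of_le (n := ∞) (by simpa using! ENat.LEInfty.out)

theorem isManifold_minSmoothness_three (n : ℕ) (M : Type*) [TopologicalSpace M]
    [ChartedSpace (EuclideanSpace ℝ (Fin n)) M] [IsManifold (𝓡 n) ∞ M] :
    IsManifold (𝓡 n) (minSmoothness ℝ 3) M :=
  IsManifold.of_le (n := ∞) (by simpa using! ENat.LEInfty.out)

namespace TangentDistribution

variable {n : ℕ} {M : Type*} [TopologicalSpace M] [ChartedSpace (EuclideanSpace ℝ (Fin n)) M]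
  [IsManifold (𝓡 n) ∞ M]

theorem IsSectionOn.contMDiffAt {D : TangentDistribution n M} {U : Set M}
    {X : ∀ y : M, TangentSpace (𝓡 n) y} (hX : D.IsSectionOn U X) (hU : IsOpen U) {x : M}
    (hx : x ∈ U) :
    ContMDiffAt (𝓡 n) (𝓡 n).tangent ∞ (fun y => (⟨y, X y⟩ : TangentBundle (𝓡 n) M)) x :=
  (hX.1 x hx).contMDiffAt (hU.mem_nhds hx)

theorem IsSectionOn.mono {D D' : TangentDistribution n M} {U U' : Set M}
    {X : ∀ y : M, TangentSpace (𝓡 n) y} (hX : D.IsSectionOn U X) (hU : U' ⊆ U)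
    (hD : ∀ x, D x ≤ D' x) : D'.IsSectionOn U' X :=
  ⟨hX.1.mono hU, fun x hx => hD x (hX.2 x (hU hx))⟩

theorem IsSectionOn.add {D : TangentDistribution n M} {U : Set M}
    {X Y : ∀ y : M, TangentSpace (𝓡 n) y} (hX : D.IsSectionOn U X) (hY : D.IsSectionOn U Y) :
    D.IsSectionOn U (fun y => X y + Y y) :=
  ⟨ContMDiffOn.add_section hX.1 hY.1, fun x hx => (D x).add_mem (hX.2 x hx) (hY.2 x hx)⟩

theorem IsSectionOn.const_smul {D : TangentDistribution n M} {U : Set M}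
    {X : ∀ y : M, TangentSpace (𝓡 n) y} (hX : D.IsSectionOn U X) (a : ℝ) :
    D.IsSectionOn U (fun y => a • X y) :=
  ⟨ContMDiffOn.const_smul_section hX.1, fun x hx => (D x).smul_mem a (hX.2 x hx)⟩

theorem IsSectionOn.mlieBracket {D : TangentDistribution n M} {U : Set M} (hU : IsOpen U)
    {X Y : ∀ y : M, TangentSpace (𝓡 n) y} (hX : D.IsSectionOn U X) (hY : D.IsSectionOn U Y) :
    D.derivedOnce.IsSectionOn U (VectorField.mlieBracket (𝓡 n) X Y) := by
  have : IsManifold (𝓡 n) (((⊤ : ℕ∞) : ℕ∞ω) + 1) M := IsManifold.of_le (n := ∞) (by simp)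
  have := isManifold_minSmoothness_two n M
  have := isManifold_minSmoothness_three n M
  refine ⟨fun x hx => ContMDiffAt.contMDiffWithinAt ?_, fun x hx => ?_⟩
  · exact ContMDiffAt.mlieBracket_vectorField (m := ⊤) (n := ⊤) (hX.contMDiffAt hU hx)
      (hY.contMDiffAt hU hx) (by simp)
  · exact Submodule.mem_sup_right (Submodule.subset_span ⟨U, X, Y, hU, hx, hX, hY, rfl⟩)

/-- The values at `x` of smooth local sections of `D`. -/
def sectionValues (D : TangentDistribution n M) (x : M) : Submodule ℝ (TangentSpace (𝓡 n) x) where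
  carrier := {v | ∃ (U : Set M) (X : ∀ y : M, TangentSpace (𝓡 n) y),
    IsOpen U ∧ x ∈ U ∧ D.IsSectionOn U X ∧ X x = v}
  zero_mem' := ⟨Set.univ, fun y => (0 : TangentSpace (𝓡 n) y), isOpen_univ, trivial,
    ⟨(Bundle.contMDiff_zeroSection ℝ (TangentSpace (𝓡 n))).contMDiffOn, fun y _ => (D y).zero_mem⟩,
    rfl⟩
  add_mem' := by
    rintro v w ⟨U, X, hU, hxU, hX, rfl⟩ ⟨U', Y, hU', hxU', hY, rfl⟩
    exact ⟨U ∩ U', fun y => X y + Y y, hU.inter hU', ⟨hxU, hxU'⟩,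
      (hX.mono Set.inter_subset_left fun _ => le_rfl).add
        (hY.mono Set.inter_subset_right fun _ => le_rfl), rfl⟩
  smul_mem' := by
    rintro a v ⟨U, X, hU, hxU, hX, rfl⟩
    exact ⟨U, fun y => a • X y, hU, hxU, hX.const_smul a, rfl⟩

/-- Every vector of `D` is the value of a smooth local section of `D`. -/
def HasLocalSections (D : TangentDistribution n M) : Prop :=
  ∀ x, D x ≤ D.sectionValues x

theorem sectionValues_mono {D D' : TangentDistribution n M} (h : ∀ x, D x ≤ D' x) (x : M) :
    D.sectionValues x ≤ D'.sectionValues x := by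
  rintro v ⟨U, X, hU, hxU, hX, rfl⟩
  exact ⟨U, X, hU, hxU, hX.mono subset_rfl h, rfl⟩

theorem le_derivedOnce (D : TangentDistribution n M) (x : M) : D x ≤ D.derivedOnce x :=
  le_sup_left

theorem derivedOnce_mono {D D' : TangentDistribution n M} (h : ∀ x, D x ≤ D' x) (x : M) :
    D.derivedOnce x ≤ D'.derivedOnce x := by
  refine sup_le_sup (h x) (Submodule.span_mono ?_)
  rintro v ⟨U, X, Y, hU, hxU, hX, hY, rfl⟩
  exact ⟨U, X, Y, hU, hxU, hX.mono subset_rfl h, hY.mono subset_rfl h, rfl⟩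

theorem HasLocalSections.derivedOnce {D : TangentDistribution n M} (hD : D.HasLocalSections) :
    D.derivedOnce.HasLocalSections := by
  intro x
  refine sup_le ((hD x).trans (sectionValues_mono D.le_derivedOnce x)) (Submodule.span_le.2 ?_)
  rintro v ⟨U, X, Y, hU, hxU, hX, hY, rfl⟩
  exact ⟨U, _, hU, hxU, hX.mlieBracket hU hY, rfl⟩

theorem HasLocalSections.derived {D : TangentDistribution n M} (hD : D.HasLocalSections) (j : ℕ) :
    (D.derived j).HasLocalSections := by
  induction j with
  | zero => exact hD
  | succ j ih => exact ih.derivedOnce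

theorem HasLocalSections.sum {D D' : TangentDistribution n M} (hD : D.HasLocalSections)
    (hD' : D'.HasLocalSections) : (D.sum D').HasLocalSections := fun x =>
  sup_le ((hD x).trans (sectionValues_mono (fun _ => le_sup_left) x))
    ((hD' x).trans (sectionValues_mono (fun _ => le_sup_right) x))

end TangentDistribution

/-! ### Naturality under diffeomorphisms -/

section Diffeo

variable {n : ℕ} {M : Type*} [TopologicalSpace M] [ChartedSpace (EuclideanSpace ℝ (Fin n)) M]

/-- All tangent spaces are definitionally the model space, so membership can be transported along an
equality of base points without casts. -/
theorem TangentDistribution.mem_of_eq (D : TangentDistribution n M) {x y : M} (h : x = y)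
    {v : EuclideanSpace ℝ (Fin n)}
    (hv : v ∈ (D x : Submodule ℝ (EuclideanSpace ℝ (Fin n)))) :
    v ∈ (D y : Submodule ℝ (EuclideanSpace ℝ (Fin n))) := by
  subst h; exact hv

theorem mfderiv_comp_mfderiv_of_leftInverse {f h : M → M} (hf : ContMDiff (𝓡 n) (𝓡 n) ∞ f)
    (hh : ContMDiff (𝓡 n) (𝓡 n) ∞ h) (hhf : ∀ x, h (f x) = x) {x y : M} (hxy : f x = y) :
    (mfderiv (𝓡 n) (𝓡 n) h y : EuclideanSpace ℝ (Fin n) →L[ℝ] EuclideanSpace ℝ (Fin n)).comp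
      (mfderiv (𝓡 n) (𝓡 n) f x : EuclideanSpace ℝ (Fin n) →L[ℝ] EuclideanSpace ℝ (Fin n)) =
      ContinuousLinearMap.id ℝ _ := by
  subst hxy
  have h1 := mfderiv_comp_of_eq (x := x) (hh.mdifferentiableAt (by simp) (x := f x))
    (hf.mdifferentiableAt (by simp)) rfl
  have h2 : h ∘ f = id := funext hhf
  rw [h2, mfderiv_id] at h1
  exact h1.symm

theorem isInvertible_mfderiv_of_inverse {f h : M → M} (hf : ContMDiff (𝓡 n) (𝓡 n) ∞ f)
    (hh : ContMDiff (𝓡 n) (𝓡 n) ∞ h) (hhf : ∀ x, h (f x) = x) (hfh : ∀ x, f (h x) = x) (y : M) :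
    (mfderiv (𝓡 n) (𝓡 n) h y).IsInvertible :=
  ContinuousLinearMap.IsInvertible.of_inverse
    (mfderiv_comp_mfderiv_of_leftInverse hf hh hhf (hfh y))
    (mfderiv_comp_mfderiv_of_leftInverse hh hf hfh rfl)

theorem inverse_mfderiv_of_inverse {f h : M → M} (hf : ContMDiff (𝓡 n) (𝓡 n) ∞ f)
    (hh : ContMDiff (𝓡 n) (𝓡 n) ∞ h) (hhf : ∀ x, h (f x) = x) (hfh : ∀ x, f (h x) = x) {x y : M}
    (hxy : f x = y) :
    ((mfderiv (𝓡 n) (𝓡 n) h y).inverse : EuclideanSpace ℝ (Fin n) →L[ℝ] EuclideanSpace ℝ (Fin n)) =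
      (mfderiv (𝓡 n) (𝓡 n) f x : EuclideanSpace ℝ (Fin n) →L[ℝ] EuclideanSpace ℝ (Fin n)) :=
  ContinuousLinearMap.inverse_eq
    (mfderiv_comp_mfderiv_of_leftInverse hf hh hhf hxy)
    (mfderiv_comp_mfderiv_of_leftInverse hh hf hfh (by rw [← hxy, hhf]))

variable [IsManifold (𝓡 n) ∞ M]

namespace TangentDistribution

theorem IsSectionOn.mpullback {D : TangentDistribution n M} {f h : M → M}
    (hf : ContMDiff (𝓡 n) (𝓡 n) ∞ f) (hh : ContMDiff (𝓡 n) (𝓡 n) ∞ h) (hhf : ∀ x, h (f x) = x)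
    (hfh : ∀ x, f (h x) = x)
    (hD : ∀ x, (D x).map (mfderiv (𝓡 n) (𝓡 n) f x).toLinearMap ≤ D (f x)) {U : Set M}
    {X : ∀ y : M, TangentSpace (𝓡 n) y} (hX : D.IsSectionOn U X) :
    D.IsSectionOn (h ⁻¹' U) (mpullback (𝓡 n) (𝓡 n) h X) := by
  refine ⟨?_, fun y hy => ?_⟩
  · exact ContMDiffOn.mpullback_vectorField_preimage hX.1 hh
      (fun y _ => isInvertible_mfderiv_of_inverse hf hh hhf hfh y) (by simp)
  · have h1 : (mfderiv (𝓡 n) (𝓡 n) f (h y)) (X (h y)) ∈ D (f (h y)) :=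
      hD _ (Submodule.mem_map_of_mem (hX.2 _ hy))
    have h2 := D.mem_of_eq (hfh y) h1
    rwa [← inverse_mfderiv_of_inverse hf hh hhf hfh (hfh y)] at h2

/-- Pulling back along the inverse `h` is pushing forward along `f`; it preserves sections of `D`
and commutes with brackets. -/
theorem map_derivedOnce_le {D : TangentDistribution n M} {f h : M → M}
    (hf : ContMDiff (𝓡 n) (𝓡 n) ∞ f) (hh : ContMDiff (𝓡 n) (𝓡 n) ∞ h) (hhf : ∀ x, h (f x) = x)
    (hfh : ∀ x, f (h x) = x)
    (hD : ∀ x, (D x).map (mfderiv (𝓡 n) (𝓡 n) f x).toLinearMap ≤ D (f x)) (x : M) :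
    (D.derivedOnce x).map (mfderiv (𝓡 n) (𝓡 n) f x).toLinearMap ≤ D.derivedOnce (f x) := by
  have := isManifold_minSmoothness_two n M
  rw [derivedOnce, Submodule.map_sup]
  refine sup_le ((hD x).trans le_sup_left) ?_
  rw [Submodule.map_span, Submodule.span_le]
  rintro _ ⟨_, ⟨U, X, Y, hU, hxU, hX, hY, rfl⟩, rfl⟩
  have hbr := (hX.mpullback hf hh hhf hfh hD).mlieBracket (hU.preimage hh.continuous)
    (hY.mpullback hf hh hhf hfh hD)
  have hmem := hbr.2 (f x) (by simpa [hhf x] using hxU)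
  have hxU' : h (f x) ∈ U := (hhf x).symm ▸ hxU
  rw [← mpullback_mlieBracket (n := ∞) ((hX.contMDiffAt hU hxU').mdifferentiableAt (by simp))
    ((hY.contMDiffAt hU hxU').mdifferentiableAt (by simp)) hh.contMDiffAt
    (by simpa using! ENat.LEInfty.out)] at hmem
  have key : (mpullback (𝓡 n) (𝓡 n) h (mlieBracket (𝓡 n) X Y) (f x) :
      EuclideanSpace ℝ (Fin n)) = mfderiv (𝓡 n) (𝓡 n) f x (mlieBracket (𝓡 n) X Y x) := by
    have h1 : ((mfderiv (𝓡 n) (𝓡 n) h (f x)).inverse :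
        EuclideanSpace ℝ (Fin n) →L[ℝ] EuclideanSpace ℝ (Fin n)) =
        (mfderiv (𝓡 n) (𝓡 n) f x : EuclideanSpace ℝ (Fin n) →L[ℝ] EuclideanSpace ℝ (Fin n)) :=
      inverse_mfderiv_of_inverse hf hh hhf hfh (x := x) rfl
    have h2 : (mlieBracket (𝓡 n) X Y (h (f x)) : EuclideanSpace ℝ (Fin n)) =
      mlieBracket (𝓡 n) X Y x := by rw [hhf x]
    exact (DFunLike.congr_fun h1 _).trans (congrArg
      (mfderiv (𝓡 n) (𝓡 n) f x : EuclideanSpace ℝ (Fin n) →L[ℝ] EuclideanSpace ℝ (Fin n)) h2)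
  exact key ▸ hmem

end TangentDistribution

end Diffeo

theorem mfderiv_eq_of_eq {n m : ℕ} {M N : Type*} [TopologicalSpace M]
    [ChartedSpace (EuclideanSpace ℝ (Fin n)) M] [TopologicalSpace N]
    [ChartedSpace (EuclideanSpace ℝ (Fin m)) N] {f : M → N} {x y : M} (h : x = y) :
    (mfderiv (𝓡 n) (𝓡 m) f x : EuclideanSpace ℝ (Fin n) →L[ℝ] EuclideanSpace ℝ (Fin m)) =
      (mfderiv (𝓡 n) (𝓡 m) f y : EuclideanSpace ℝ (Fin n) →L[ℝ] EuclideanSpace ℝ (Fin m)) := by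
  subst h; rfl

/-! ### Invariance of the derived bundles and of the generators -/

section Action

variable {n r : ℕ} {M : Type*} [TopologicalSpace M] [ChartedSpace (EuclideanSpace ℝ (Fin n)) M]
  {G : Type*} [TopologicalSpace G] [ChartedSpace (EuclideanSpace ℝ (Fin r)) G] [Group G]
  {μ : M → G → M}

theorem IsSmoothRightAction.contMDiff_act (hμ : IsSmoothRightAction n r μ) (g : G) :
    ContMDiff (𝓡 n) (𝓡 n) ∞ fun y => μ y g :=
  hμ.smooth.comp (f := fun y => (y, g)) (contMDiff_id.prodMk contMDiff_const)

theorem IsSmoothRightAction.contMDiff_orbit (hμ : IsSmoothRightAction n r μ) (x : M) :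
    ContMDiff (𝓡 r) (𝓡 n) ∞ (μ x) :=
  hμ.smooth.comp (f := fun g => (x, g)) (contMDiff_const.prodMk contMDiff_id)

theorem IsSmoothRightAction.act_inv_act (hμ : IsSmoothRightAction n r μ) (g : G) (x : M) :
    μ (μ x g) g⁻¹ = x := by rw [hμ.act_mul, mul_inv_cancel, hμ.act_one]

theorem IsSmoothRightAction.act_act_inv (hμ : IsSmoothRightAction n r μ) (g : G) (x : M) :
    μ (μ x g⁻¹) g = x := by rw [hμ.act_mul, inv_mul_cancel, hμ.act_one]

/-- The reverse inclusion comes from applying the hypothesis to `g⁻¹`. -/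
theorem IsSmoothRightAction.isInvariantUnder_of_map_le (hμ : IsSmoothRightAction n r μ)
    {W : TangentDistribution n M}
    (h : ∀ (g : G) (x : M),
      (W x).map (mfderiv (𝓡 n) (𝓡 n) (fun y => μ y g) x).toLinearMap ≤ W (μ x g)) :
    IsInvariantUnder W μ := by
  intro g x
  refine le_antisymm (h g x) fun v hv => ?_
  have h1 := W.mem_of_eq (hμ.act_inv_act g x) (h g⁻¹ (μ x g) (Submodule.mem_map_of_mem hv))
  refine ⟨_, h1, ?_⟩
  exact DFunLike.congr_fun (mfderiv_comp_mfderiv_of_leftInverse (hμ.contMDiff_act g⁻¹)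
    (hμ.contMDiff_act g) (hμ.act_act_inv g) (hμ.act_inv_act g x)) v

theorem IsSmoothRightAction.isInvariantUnder_derivedOnce [IsManifold (𝓡 n) ∞ M]
    (hμ : IsSmoothRightAction n r μ) {W : TangentDistribution n M} (hW : IsInvariantUnder W μ) :
    IsInvariantUnder W.derivedOnce μ :=
  hμ.isInvariantUnder_of_map_le fun g x =>
    TangentDistribution.map_derivedOnce_le (hμ.contMDiff_act g) (hμ.contMDiff_act g⁻¹)
      (hμ.act_inv_act g) (hμ.act_act_inv g) (fun y => (hW g y).le) x

theorem IsSmoothRightAction.isInvariantUnder_derived [IsManifold (𝓡 n) ∞ M]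
    (hμ : IsSmoothRightAction n r μ) {W : TangentDistribution n M} (hW : IsInvariantUnder W μ)
    (j : ℕ) : IsInvariantUnder (W.derived j) μ := by
  induction j with
  | zero => exact hW
  | succ j ih => exact hμ.isInvariantUnder_derivedOnce ih

theorem IsSmoothRightAction.isInvariantUnder_generatorBundle [LieGroup (𝓡 r) ∞ G]
    (hμ : IsSmoothRightAction n r μ) : IsInvariantUnder (generatorBundle n r μ) μ := by
  refine hμ.isInvariantUnder_of_map_le fun g x => ?_
  rw [generatorBundle, Submodule.map_span, Submodule.span_le]
  rintro _ ⟨_, ⟨ξ, rfl⟩, rfl⟩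
  -- Since x·h·g = (x·g)·(g⁻¹hg), the differential of `μ_g` sends the generator of `ξ` to that of
  -- `dc ξ`.
  let c : G → G := fun h => g⁻¹ * h * g
  have hc : ContMDiff (𝓡 r) (𝓡 r) ∞ c :=
    (contMDiff_const.mul contMDiff_id).mul contMDiff_const
  have hc1 : c 1 = 1 := by simp [c]
  have hcomp : (fun y => μ y g) ∘ μ x = μ (μ x g) ∘ c := by
    funext h
    simp [c, hμ.act_mul, mul_assoc]
  have h1 := mfderiv_comp (1 : G) ((hμ.contMDiff_act g).mdifferentiableAt (by simp))
    ((hμ.contMDiff_orbit x).mdifferentiableAt (by simp))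
  have h2 := mfderiv_comp (1 : G)
    ((hμ.contMDiff_orbit (μ x g)).mdifferentiableAt (by simp)) (hc.mdifferentiableAt (by simp))
  rw [hcomp, h2] at h1
  have h3 : (infinitesimalGenerator n r μ (mfderiv (𝓡 r) (𝓡 r) c 1 ξ : EuclideanSpace ℝ (Fin r))
      (μ x g) : EuclideanSpace ℝ (Fin n)) =
      mfderiv (𝓡 n) (𝓡 n) (fun y => μ y g) x (infinitesimalGenerator n r μ ξ x) :=
    (DFunLike.congr_fun (mfderiv_eq_of_eq (f := μ (μ x g)) (x := 1) (y := c 1) hc1.symm) _).trans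
      ((DFunLike.congr_fun h1 ξ).trans
        (DFunLike.congr_fun (mfderiv_eq_of_eq (f := fun y => μ y g) (x := μ x 1) (y := x)
          (hμ.act_one x)) _))
  exact Submodule.subset_span ⟨_, h3⟩

theorem IsSmoothRightAction.contMDiff_infinitesimalGenerator [IsManifold (𝓡 n) ∞ M]
    [LieGroup (𝓡 r) ∞ G] (hμ : IsSmoothRightAction n r μ) (ξ : TangentSpace (𝓡 r) (1 : G)) :
    ContMDiff (𝓡 n) (𝓡 n).tangent ∞
      fun x => (⟨x, infinitesimalGenerator n r μ ξ x⟩ : TangentBundle (𝓡 n) M) := by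
  have : IsManifold (𝓡 r) ∞ G := inferInstance
  -- The generator at `x` is dμ applied to `(0, ξ)` at `(x, 1)`: a smooth section followed by the
  -- tangent map of `μ`.
  have h1 : ContMDiff (𝓡 n) ((𝓡 n).tangent.prod (𝓡 r).tangent) ∞ fun x : M =>
      ((⟨x, 0⟩, ⟨1, ξ⟩) : TangentBundle (𝓡 n) M × TangentBundle (𝓡 r) G) :=
    (Bundle.contMDiff_zeroSection ℝ (TangentSpace (𝓡 n))).prodMk contMDiff_const
  have h2 := (hμ.smooth.contMDiff_tangentMap (m := ∞) (by simp)).comp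
    (contMDiff_equivTangentBundleProd_symm.comp h1)
  refine h2.congr fun x => ?_
  have h3 : mfderiv ((𝓡 n).prod (𝓡 r)) (𝓡 n) (fun p : M × G => μ p.1 p.2) (x, 1)
      ((0, ξ) : EuclideanSpace ℝ (Fin n) × EuclideanSpace ℝ (Fin r)) =
      mfderiv (𝓡 r) (𝓡 n) (μ x) 1 ξ := by
    refine (mfderiv_prod_eq_add_apply (p := (x, (1 : G)))
      (hμ.smooth.mdifferentiableAt (by simp))).trans ?_
    exact (congrArg₂ (· + ·) (map_zero _) rfl).trans (zero_add _)
  have h4 : ∀ {y : M} (_ : y = x) (v : EuclideanSpace ℝ (Fin n)),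
      (⟨x, v⟩ : TangentBundle (𝓡 n) M) = ⟨y, v⟩ := by rintro _ rfl v; rfl
  refine (h4 (hμ.act_one x) _).trans ?_
  exact congrArg (fun v => (⟨μ x 1, v⟩ : TangentBundle (𝓡 n) M)) h3.symm

theorem IsSmoothRightAction.hasLocalSections_generatorBundle [IsManifold (𝓡 n) ∞ M]
    [LieGroup (𝓡 r) ∞ G] (hμ : IsSmoothRightAction n r μ) :
    (generatorBundle n r μ).HasLocalSections := by
  intro x
  rw [generatorBundle, Submodule.span_le]
  rintro _ ⟨ξ, rfl⟩
  exact ⟨Set.univ, infinitesimalGenerator n r μ ξ, isOpen_univ, trivial,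
    ⟨(hμ.contMDiff_infinitesimalGenerator ξ).contMDiffOn,
      fun y _ => Submodule.subset_span ⟨ξ, rfl⟩⟩, rfl⟩

end Action

/-! ### Charts and curves with given velocity -/

section Charts

variable {n : ℕ} {M : Type*} [TopologicalSpace M] [ChartedSpace (EuclideanSpace ℝ (Fin n)) M]
  [IsManifold (𝓡 n) ∞ M]

theorem inverse_mfderivWithin_extChartAt_symm (x : M) {u : EuclideanSpace ℝ (Fin n)}
    (hu : u ∈ (extChartAt (𝓡 n) x).target) :
    (mfderivWithin 𝓘(ℝ, EuclideanSpace ℝ (Fin n)) (𝓡 n) (extChartAt (𝓡 n) x).symm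
      (Set.range (𝓡 n)) u).inverse =
      mfderiv (𝓡 n) 𝓘(ℝ, EuclideanSpace ℝ (Fin n)) (extChartAt (𝓡 n) x)
        ((extChartAt (𝓡 n) x).symm u) :=
  ContinuousLinearMap.inverse_eq (mfderivWithin_extChartAt_symm_comp_mfderiv_extChartAt hu)
    (mfderiv_extChartAt_comp_mfderivWithin_extChartAt_symm hu)

theorem contMDiffAt_extChartAt_symm (x : M) {u : EuclideanSpace ℝ (Fin n)}
    (hu : u ∈ (extChartAt (𝓡 n) x).target) :
    ContMDiffAt 𝓘(ℝ, EuclideanSpace ℝ (Fin n)) (𝓡 n) ∞ (extChartAt (𝓡 n) x).symm u :=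
  (contMDiffOn_extChartAt_symm x).contMDiffAt ((isOpen_extChartAt_target x).mem_nhds hu)

theorem mfderiv_extChartAt_symm_mfderiv_extChartAt (x : M) (v : EuclideanSpace ℝ (Fin n)) :
    (mfderiv 𝓘(ℝ, EuclideanSpace ℝ (Fin n)) (𝓡 n) (extChartAt (𝓡 n) x).symm
      (extChartAt (𝓡 n) x x) : EuclideanSpace ℝ (Fin n) →L[ℝ] EuclideanSpace ℝ (Fin n))
      ((mfderiv (𝓡 n) 𝓘(ℝ, EuclideanSpace ℝ (Fin n)) (extChartAt (𝓡 n) x) x :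
        EuclideanSpace ℝ (Fin n) →L[ℝ] EuclideanSpace ℝ (Fin n)) v) = v := by
  have h := mfderivWithin_extChartAt_symm_comp_mfderiv_extChartAt' (I := 𝓡 n)
    (mem_extChartAt_source (I := 𝓡 n) x)
  rw [ModelWithCorners.range_eq_univ, mfderivWithin_univ] at h
  exact DFunLike.congr_fun h v

/-- A smooth curve through `x` with prescribed velocity. -/
theorem exists_contMDiffAt_curve (x : M) (v : EuclideanSpace ℝ (Fin n)) :
    ∃ γ : ℝ → M, γ 0 = x ∧ ContMDiffAt 𝓘(ℝ) (𝓡 n) ∞ γ 0 ∧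
      (mfderiv 𝓘(ℝ) (𝓡 n) γ 0 : ℝ →L[ℝ] EuclideanSpace ℝ (Fin n)) 1 = v := by
  let φ := extChartAt (𝓡 n) x
  let a : EuclideanSpace ℝ (Fin n) :=
    (mfderiv (𝓡 n) 𝓘(ℝ, EuclideanSpace ℝ (Fin n)) φ x :
        EuclideanSpace ℝ (Fin n) →L[ℝ] EuclideanSpace ℝ (Fin n)) v
  let l : ℝ → EuclideanSpace ℝ (Fin n) := fun t => φ x + t • a
  have hl0 : l 0 = φ x := by simp [l]
  have hl : ContDiff ℝ ∞ l := by fun_prop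
  have hψ : ContMDiffAt 𝓘(ℝ, EuclideanSpace ℝ (Fin n)) (𝓡 n) ∞ φ.symm (l 0) := by
    rw [hl0]; exact contMDiffAt_extChartAt_symm x (mem_extChartAt_target x)
  have hld : HasDerivAt l a 0 := by
    simpa [l] using ((hasDerivAt_id (0 : ℝ)).smul_const a).const_add (φ x)
  refine ⟨φ.symm ∘ l, ?_, hψ.comp 0 hl.contMDiff.contMDiffAt, ?_⟩
  · simp [hl0, φ]
  · have h1 := mfderiv_comp (0 : ℝ) (hψ.mdifferentiableAt (by simp))
      (hl.contMDiff.contMDiffAt.mdifferentiableAt (by simp))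
    rw [h1]
    have h2 : (mfderiv 𝓘(ℝ) 𝓘(ℝ, EuclideanSpace ℝ (Fin n)) l 0 :
        ℝ →L[ℝ] EuclideanSpace ℝ (Fin n)) 1 = a := by
      rw [mfderiv_eq_fderiv]
      exact hld.deriv
    have h3 := mfderiv_eq_of_eq (n := n) (m := n) (f := φ.symm) hl0
    refine (congrArg (mfderiv 𝓘(ℝ, EuclideanSpace ℝ (Fin n)) (𝓡 n) φ.symm (l 0) :
      EuclideanSpace ℝ (Fin n) →L[ℝ] EuclideanSpace ℝ (Fin n)) h2).trans ?_
    refine (DFunLike.congr_fun h3 a).trans ?_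
    exact mfderiv_extChartAt_symm_mfderiv_extChartAt x v

end Charts

/-! ### Infinitesimal invariance on the manifold -/

section Action

variable {n r : ℕ} {M : Type*} [TopologicalSpace M] [ChartedSpace (EuclideanSpace ℝ (Fin n)) M]
  [IsManifold (𝓡 n) ∞ M]
  {G : Type*} [TopologicalSpace G] [ChartedSpace (EuclideanSpace ℝ (Fin r)) G] [Group G]
  [LieGroup (𝓡 r) ∞ G] {μ : M → G → M}

/-- The bracket of an infinitesimal generator with a local section of an invariant distribution
is tangent to the distribution. -/
theorem IsSmoothRightAction.mlieBracket_infinitesimalGenerator_mem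
    (hμ : IsSmoothRightAction n r μ) {W : TangentDistribution n M} (hW : IsInvariantUnder W μ)
    {U : Set M} (hU : IsOpen U) {x : M} (hx : x ∈ U) {X : ∀ y : M, TangentSpace (𝓡 n) y}
    (hX : W.IsSectionOn U X) (ξ : TangentSpace (𝓡 r) (1 : G)) :
    mlieBracket (𝓡 n) (infinitesimalGenerator n r μ ξ) X x ∈ W x := by
  have : IsManifold (𝓡 r) ∞ G := inferInstance
  let φ := extChartAt (𝓡 n) x
  let dφ : M → EuclideanSpace ℝ (Fin n) →L[ℝ] EuclideanSpace ℝ (Fin n) := fun y =>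
    mfderiv (𝓡 n) 𝓘(ℝ, EuclideanSpace ℝ (Fin n)) φ y
  have hu₀ : φ x ∈ φ.target := mem_extChartAt_target x
  have hψx : φ.symm (φ x) = x := extChartAt_to_inv x
  have htarget : ∀ᶠ u in 𝓝 (φ x), u ∈ φ.target := (isOpen_extChartAt_target x).mem_nhds hu₀
  have hsource : ∀ᶠ y in 𝓝 x, y ∈ φ.source := extChartAt_source_mem_nhds x
  have hφd : ∀ y ∈ φ.source, ContMDiffAt (𝓡 n) 𝓘(ℝ, EuclideanSpace ℝ (Fin n)) ∞ φ y :=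
    fun y hy => contMDiffAt_extChartAt' (by simpa [φ] using hy)
  obtain ⟨γ, hγ0, hγ, hγξ⟩ := exists_contMDiffAt_curve (1 : G) ξ
  -- The action of `γ t` read in the chart. Only the velocity of `γ` at 0 matters, so no exponential
  -- map or flow is needed.
  let F : ℝ × EuclideanSpace ℝ (Fin n) → EuclideanSpace ℝ (Fin n) := fun p =>
    φ (μ (φ.symm p.2) (γ p.1))
  have hFsm : ∀ u ∈ φ.target, ContDiffAt ℝ ∞ F (0, u) := by
    intro u hu
    rw [← contMDiffAt_iff_contDiffAt]
    have h1 : ContMDiffAt 𝓘(ℝ, ℝ × EuclideanSpace ℝ (Fin n)) (𝓡 n) ∞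
        (fun p : ℝ × EuclideanSpace ℝ (Fin n) => φ.symm p.2) (0, u) :=
      ContMDiffAt.comp (g := φ.symm) (f := Prod.snd) _ (contMDiffAt_extChartAt_symm x hu)
        contDiff_snd.contMDiff.contMDiffAt
    have h2 : ContMDiffAt 𝓘(ℝ, ℝ × EuclideanSpace ℝ (Fin n)) (𝓡 r) ∞
        (fun p : ℝ × EuclideanSpace ℝ (Fin n) => γ p.1) (0, u) :=
      ContMDiffAt.comp (g := γ) (f := Prod.fst) _ hγ contDiff_fst.contMDiff.contMDiffAt
    have h3 : ContMDiffAt 𝓘(ℝ, ℝ × EuclideanSpace ℝ (Fin n)) (𝓡 n) ∞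
        (fun p : ℝ × EuclideanSpace ℝ (Fin n) => μ (φ.symm p.2) (γ p.1)) (0, u) :=
      ContMDiffAt.comp (g := fun q : M × G => μ q.1 q.2) _ hμ.smooth.contMDiffAt (h1.prodMk h2)
    refine ContMDiffAt.comp (g := φ) _ (hφd _ ?_) h3
    simpa [hγ0, hμ.act_one] using φ.map_target hu
  have hF0 : ∀ᶠ u in 𝓝 (φ x), F (0, u) = u := by
    filter_upwards [htarget] with u hu
    simp only [F, hγ0, hμ.act_one]
    exact φ.right_inv hu
  let Z' : EuclideanSpace ℝ (Fin n) → EuclideanSpace ℝ (Fin n) :=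
    mpullbackWithin 𝓘(ℝ, EuclideanSpace ℝ (Fin n)) (𝓡 n) φ.symm
    (infinitesimalGenerator n r μ ξ) (Set.range (𝓡 n))
  let X' : EuclideanSpace ℝ (Fin n) → EuclideanSpace ℝ (Fin n) :=
    mpullbackWithin 𝓘(ℝ, EuclideanSpace ℝ (Fin n)) (𝓡 n) φ.symm X (Set.range (𝓡 n))
  have hpull : ∀ (Y : ∀ y : M, TangentSpace (𝓡 n) y), ∀ u ∈ φ.target,
      mpullbackWithin 𝓘(ℝ, EuclideanSpace ℝ (Fin n)) (𝓡 n) φ.symm Y (Set.range (𝓡 n)) u =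
        dφ (φ.symm u) (Y (φ.symm u)) := fun Y u hu =>
    DFunLike.congr_fun (inverse_mfderivWithin_extChartAt_symm x hu) _
  have hZ : ∀ᶠ u in 𝓝 (φ x), Z' u = fderiv ℝ F (0, u) (1, 0) := by
    filter_upwards [htarget] with u hu
    have h1 : HasDerivAt (fun t : ℝ => F (t, u)) (fderiv ℝ F (0, u) (1, 0)) 0 :=
      HasFDerivAt.comp_hasDerivAt (f := fun t : ℝ => ((t, u) : ℝ × EuclideanSpace ℝ (Fin n))) 0
        ((hFsm u hu).differentiableAt (by simp)).hasFDerivAt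
        ((hasDerivAt_id (0 : ℝ)).prodMk (hasDerivAt_const (0 : ℝ) u))
    have hpt : μ (φ.symm u) (γ 0) = φ.symm u := by rw [hγ0, hμ.act_one]
    have h2 : HasMFDerivAt 𝓘(ℝ) 𝓘(ℝ, EuclideanSpace ℝ (Fin n)) (φ ∘ μ (φ.symm u) ∘ γ) 0
        ((mfderiv (𝓡 n) 𝓘(ℝ, EuclideanSpace ℝ (Fin n)) φ (μ (φ.symm u) (γ 0))).comp
          ((mfderiv (𝓡 r) (𝓡 n) (μ (φ.symm u)) (γ 0)).comp (mfderiv 𝓘(ℝ) (𝓡 r) γ 0))) := by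
      refine HasMFDerivAt.comp _ ?_ (HasMFDerivAt.comp _ ?_ ?_)
      · exact ((hφd _ (by rw [Function.comp_apply, hpt]; exact φ.map_target hu)).mdifferentiableAt
          (by simp)).hasMFDerivAt
      · exact ((hμ.contMDiff_orbit _).mdifferentiableAt (by simp)).hasMFDerivAt
      · exact (hγ.mdifferentiableAt (by simp)).hasMFDerivAt
    have h2' : HasFDerivAt (φ ∘ μ (φ.symm u) ∘ γ) (_ : ℝ →L[ℝ] EuclideanSpace ℝ (Fin n)) 0 :=
      hasMFDerivAt_iff_hasFDerivAt.1 h2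
    have h3 := h2'.hasDerivAt.unique h1
    rw [← h3]
    change mpullbackWithin _ _ _ _ _ u = _
    rw [hpull _ u hu]
    have h4 := mfderiv_eq_of_eq (n := n) (m := n) (f := φ) hpt
    have h5 := mfderiv_eq_of_eq (n := r) (m := n) (f := μ (φ.symm u)) hγ0
    refine (DFunLike.congr_fun h4.symm _).trans (congrArg (dφ (μ (φ.symm u) (γ 0))) ?_)
    refine (DFunLike.congr_fun h5.symm ξ).trans ?_
    exact congrArg (mfderiv (𝓡 r) (𝓡 n) (μ (φ.symm u)) (γ 0) :
      EuclideanSpace ℝ (Fin r) →L[ℝ] EuclideanSpace ℝ (Fin n)) hγξ.symm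
  have hset : (φ.symm ⁻¹' Set.univ ∩ Set.range (𝓡 n)) = Set.univ := by simp
  have hX' : DifferentiableAt ℝ X' (φ x) := by
    have h1 := ((hX.contMDiffAt hU hx).mdifferentiableAt
      (by simp)).mdifferentiableWithinAt (s := Set.univ)
    have h2 := h1.differentiableWithinAt_mpullbackWithin_vectorField
    have h3 : DifferentiableWithinAt ℝ X' (φ.symm ⁻¹' Set.univ ∩ Set.range (𝓡 n)) (φ x) := h2
    rwa [hset, differentiableWithinAt_univ] at h3
  let Wx : Submodule ℝ (EuclideanSpace ℝ (Fin n)) := W x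
  have hmem : lieBracket ℝ Z' X' (φ x) ∈ Wx.map (dφ x).toLinearMap := by
    refine lieBracket_mem_of_eventually_mem_map ((hFsm _ hu₀).of_le ENat.LEInfty.out) hF0 hZ hX' _ ?_
    have hFev : ∀ᶠ t in 𝓝 (0 : ℝ), DifferentiableAt ℝ F (t, φ x) := by
      have h1 : ∀ᶠ p in 𝓝 ((0 : ℝ), φ x), ContDiffAt ℝ 1 F p :=
        ((hFsm _ hu₀).of_le (m := 1) ENat.LEInfty.out).eventually (by simp)
      have h2 : Continuous fun t : ℝ => (t, φ x) := by fun_prop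
      exact (h2.continuousAt.eventually h1).mono fun t ht => ht.differentiableAt (by simp)
    have horb : ContinuousAt (fun t => μ x (γ t)) 0 :=
      ContinuousAt.comp (g := μ x) (hμ.contMDiff_orbit x).continuous.continuousAt hγ.continuousAt
    have hx0 : μ x (γ 0) = x := by rw [hγ0, hμ.act_one]
    have hsrc : ∀ᶠ t in 𝓝 (0 : ℝ), μ x (γ t) ∈ φ.source :=
      horb.eventually (show ∀ᶠ y in 𝓝 (μ x (γ 0)), y ∈ φ.source by rwa [hx0])
    have hUt : ∀ᶠ t in 𝓝 (0 : ℝ), μ x (γ t) ∈ U :=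
      horb.eventually (show ∀ᶠ y in 𝓝 (μ x (γ 0)), y ∈ U by rw [hx0]; exact hU.mem_nhds hx)
    filter_upwards [hFev, hsrc, hUt] with t ht hts htU
    have hXm := hX.2 _ htU
    rw [← hW (γ t) x] at hXm
    obtain ⟨w, hw, hwX⟩ := hXm
    -- By invariance, `X` at `μ x (γ t)` is the image of some `w ∈ W x`; its chart representative is
    -- the witness.
    refine ⟨dφ x w, Submodule.mem_map_of_mem hw, ?_⟩
    have h1 : HasFDerivAt (fun u => F (t, u)) ((fderiv ℝ F (t, φ x)).comp
        (ContinuousLinearMap.inr ℝ ℝ _)) (φ x) :=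
      HasFDerivAt.comp (f := fun u => (t, u)) (φ x) ht.hasFDerivAt (hasFDerivAt_prodMk_right t _)
    have h2 : HasMFDerivAt 𝓘(ℝ, EuclideanSpace ℝ (Fin n)) 𝓘(ℝ, EuclideanSpace ℝ (Fin n))
        (φ ∘ (fun y => μ y (γ t)) ∘ φ.symm) (φ x)
        ((mfderiv (𝓡 n) 𝓘(ℝ, EuclideanSpace ℝ (Fin n)) φ (μ (φ.symm (φ x)) (γ t))).comp
          ((mfderiv (𝓡 n) (𝓡 n) (fun y => μ y (γ t)) (φ.symm (φ x))).comp
            (mfderiv 𝓘(ℝ, EuclideanSpace ℝ (Fin n)) (𝓡 n) φ.symm (φ x)))) := by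
      refine HasMFDerivAt.comp _ ?_ (HasMFDerivAt.comp _ ?_ ?_)
      · exact ((hφd _ (by rw [Function.comp_apply, hψx]; exact hts)).mdifferentiableAt
          (by simp)).hasMFDerivAt
      · exact ((hμ.contMDiff_act _).mdifferentiableAt (by simp)).hasMFDerivAt
      · exact ((contMDiffAt_extChartAt_symm x hu₀).mdifferentiableAt (by simp)).hasMFDerivAt
    have h2' : HasFDerivAt (φ ∘ (fun y => μ y (γ t)) ∘ φ.symm)
        (_ : EuclideanSpace ℝ (Fin n) →L[ℝ] EuclideanSpace ℝ (Fin n)) (φ x) :=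
      hasMFDerivAt_iff_hasFDerivAt.1 h2
    have h3 := h2'.unique h1
    have h4 := DFunLike.congr_fun h3 (dφ x w)
    refine Eq.trans ?_ h4
    have hFt : F (t, φ x) = φ (μ x (γ t)) := by simp only [F, hψx]
    have hback : φ.symm (φ (μ x (γ t))) = μ x (γ t) := φ.left_inv hts
    rw [hFt]
    refine (hpull X _ (φ.map_source hts)).trans ?_
    have h5 := mfderiv_eq_of_eq (n := n) (m := n) (f := φ)
      (hback.trans (congrArg (fun y => μ y (γ t)) hψx.symm))
    have h6 := mfderiv_eq_of_eq (n := n) (m := n) (f := fun y => μ y (γ t)) hψx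
    refine (DFunLike.congr_fun h5 _).trans (congrArg (dφ (μ (φ.symm (φ x)) (γ t))) ?_)
    have h7 : (X (φ.symm (φ (μ x (γ t)))) : EuclideanSpace ℝ (Fin n)) = X (μ x (γ t)) := by
      rw [hback]
    refine h7.trans (hwX.symm.trans ((DFunLike.congr_fun h6.symm w).trans ?_))
    exact congrArg (mfderiv (𝓡 n) (𝓡 n) (fun y => μ y (γ t)) (φ.symm (φ x)) :
      EuclideanSpace ℝ (Fin n) →L[ℝ] EuclideanSpace ℝ (Fin n))
      (mfderiv_extChartAt_symm_mfderiv_extChartAt x w).symm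
  obtain ⟨w, hw, hwb⟩ := hmem
  have hbr : (mlieBracket (𝓡 n) (infinitesimalGenerator n r μ ξ) X x : EuclideanSpace ℝ (Fin n)) =
      w := by
    rw [← mlieBracketWithin_univ, mlieBracketWithin_apply]
    change (dφ x).inverse (lieBracketWithin ℝ Z' X' (φ.symm ⁻¹' Set.univ ∩ Set.range (𝓡 n)) (φ x)) = w
    rw [hset, lieBracketWithin_univ]
    have hinv : (dφ x).IsInvertible := isInvertible_mfderiv_extChartAt (mem_extChartAt_source x)
    rw [hinv.inverse_apply_eq]
    exact hwb.symm
  exact hbr ▸ hw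

end Action

/-! ### The derived flag of the sum with the generators -/

theorem TangentDistribution.HasRank.sum {n : ℕ} {M : Type*} [TopologicalSpace M]
    [ChartedSpace (EuclideanSpace ℝ (Fin n)) M] {D D' : TangentDistribution n M} {a b c : ℕ}
    (hD : D.HasRank a) (hD' : D'.HasRank b) (hDD' : (D.inter D').HasRank c) :
    (D.sum D').HasRank (a + b - c) := by
  intro x
  have : FiniteDimensional ℝ (TangentSpace (𝓡 n) x) :=
    inferInstanceAs (FiniteDimensional ℝ (EuclideanSpace ℝ (Fin n)))
  have h := Submodule.finrank_sup_add_finrank_inf_eq (D x) (D' x)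
  rw [hD x, hD' x] at h
  have h' : Module.finrank ℝ ↥(D x ⊓ D' x) = c := hDD' x
  change Module.finrank ℝ ↥(D x ⊔ D' x) = a + b - c
  omega

section Action

variable {n r : ℕ} {M : Type*} [TopologicalSpace M] [ChartedSpace (EuclideanSpace ℝ (Fin n)) M]
  [IsManifold (𝓡 n) ∞ M]
  {G : Type*} [TopologicalSpace G] [ChartedSpace (EuclideanSpace ℝ (Fin r)) G] [Group G]
  [LieGroup (𝓡 r) ∞ G] {μ : M → G → M}

theorem IsSmoothRightAction.derivedOnce_sum_generatorBundle (hμ : IsSmoothRightAction n r μ)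
    {W : TangentDistribution n M} (hW : IsInvariantUnder W μ) (hloc : W.HasLocalSections) {d : ℕ}
    (hd : (W.sum (generatorBundle n r μ)).HasRank d) :
    (W.sum (generatorBundle n r μ)).derivedOnce = W.derivedOnce.sum (generatorBundle n r μ) := by
  funext x
  refine le_antisymm (sup_le (sup_le_sup_right (W.le_derivedOnce x) _) (Submodule.span_le.2 ?_))
    (sup_le (TangentDistribution.derivedOnce_mono (fun _ => le_sup_left) x)
      ((le_sup_right (a := W x)).trans
        (TangentDistribution.le_derivedOnce (W.sum (generatorBundle n r μ)) x)))
  rintro _ ⟨U, X, Y, hU, hxU, hX, hY, rfl⟩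
  refine TangentDistribution.mlieBracket_mem_of_spanning hd
    ({E | ∃ U : Set M, IsOpen U ∧ x ∈ U ∧ W.IsSectionOn U E} ∪
      Set.range (infinitesimalGenerator n r μ)) ?_ ?_ ?_ _
    (sup_le_sup_right (W.le_derivedOnce x) _) ?_ (hX.contMDiffAt hU hxU)
    (mem_of_superset (hU.mem_nhds hxU) hX.2) (hY.contMDiffAt hU hxU)
    (mem_of_superset (hU.mem_nhds hxU) hY.2)
  · rintro E (⟨U, hU, hxU, hE⟩ | ⟨ξ, rfl⟩)
    · exact hE.contMDiffAt hU hxU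
    · exact hμ.contMDiff_infinitesimalGenerator ξ x
  · rintro E (⟨U, hU, hxU, hE⟩ | ⟨ξ, rfl⟩)
    · filter_upwards [hU.mem_nhds hxU] with y hy
      exact Submodule.mem_sup_left (hE.2 y hy)
    · exact Eventually.of_forall fun y =>
        Submodule.mem_sup_right (Submodule.subset_span ⟨ξ, rfl⟩)
  · refine sup_le (fun v hv => ?_) (Submodule.span_mono ?_)
    · obtain ⟨U, E, hU, hxU, hE, rfl⟩ := hloc x hv
      exact Submodule.subset_span ⟨E, Or.inl ⟨U, hU, hxU, hE⟩, rfl⟩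
    · rintro _ ⟨ξ, rfl⟩
      exact ⟨_, Or.inr ⟨ξ, rfl⟩, rfl⟩
  -- Section with section lands in `W.derivedOnce`; the mixed brackets stay in `W` itself; generator
  -- with generator stays in Γ, since Γ is invariant.
  · rintro E (⟨U, hU, hxU, hE⟩ | ⟨ξ, rfl⟩) E' (⟨U', hU', hxU', hE'⟩ | ⟨ξ', rfl⟩)
    · refine Submodule.mem_sup_left (((hE.mono Set.inter_subset_left fun _ => le_rfl).mlieBracket
        (hU.inter hU') (hE'.mono Set.inter_subset_right fun _ => le_rfl)).2 x ⟨hxU, hxU'⟩)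
    · rw [mlieBracket_swap_apply]
      exact Submodule.neg_mem _ (Submodule.mem_sup_left (W.le_derivedOnce x
        (hμ.mlieBracket_infinitesimalGenerator_mem hW hU hxU hE ξ')))
    · exact Submodule.mem_sup_left (W.le_derivedOnce x
        (hμ.mlieBracket_infinitesimalGenerator_mem hW hU' hxU' hE' ξ))
    · exact Submodule.mem_sup_right (hμ.mlieBracket_infinitesimalGenerator_mem
        hμ.isInvariantUnder_generatorBundle isOpen_univ (Set.mem_univ x)
        ⟨(hμ.contMDiff_infinitesimalGenerator ξ').contMDiffOn,
          fun y _ => Submodule.subset_span ⟨ξ', rfl⟩⟩ ξ)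

theorem IsSmoothRightAction.derived_sum_generatorBundle (hμ : IsSmoothRightAction n r μ)
    {V : TangentDistribution n M} (hV : IsInvariantUnder V μ) (hloc : V.HasLocalSections)
    {d : ℕ → ℕ} (hd : ∀ j, ((V.derived j).sum (generatorBundle n r μ)).HasRank (d j)) (j : ℕ) :
    (V.sum (generatorBundle n r μ)).derived j = (V.derived j).sum (generatorBundle n r μ) := by
  induction j with
  | zero => rfl
  | succ j ih =>
    rw [TangentDistribution.derived, ih]
    exact hμ.derivedOnce_sum_generatorBundle (hμ.isInvariantUnder_derived hV j) (hloc.derived j)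
      (hd j)

end Action

/-! ### Rank count and conclusion -/

theorem mainTheorem9 {n r : ℕ}
    {M : Type*} [TopologicalSpace M] [ChartedSpace (EuclideanSpace ℝ (Fin n)) M]
    [IsManifold (𝓡 n) ∞ M]
    {G : Type*} [TopologicalSpace G] [ChartedSpace (EuclideanSpace ℝ (Fin r)) G] [Group G]
    [LieGroup (𝓡 r) ∞ G]
    (μ : M → G → M) (hμ : IsSmoothRightAction n r μ)
    (V : TangentDistribution n M) (hV : V.IsSmoothSubbundle) (hgen : V.IsBracketGenerating)
    (k : ℕ) (hk : 1 < k) (hlen : V.HasDerivedLength k)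
    (hinv : IsInvariantUnder V μ)
    -- the ranks of the derived bundles
    (m : ℕ → ℕ) (hm : ∀ i, (V.derived i).HasRank (m i))
    -- the transverse ranks
    (ρ : ℕ → ℕ) (hρ : ∀ i, ((V.derived i).inter (generatorBundle n r μ)).HasRank (ρ i))
    (ℓ : ℕ) (hℓ : 1 ≤ ℓ) (hℓk : ℓ ≤ k - 1)
    (htrans : IsTransverse V (generatorBundle n r μ) ℓ) :
    (∀ x : M, Disjoint (V x) (generatorBundle n r μ x)) ∧
    ∃ khat : ℕ, 1 ≤ khat ∧ khat ≤ k ∧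
      (V.sum (generatorBundle n r μ)).HasDerivedLength khat ∧
      (V.sum (generatorBundle n r μ)).HasDeceleration
        (signatureList khat (fun j => rankDiff₂ ρ j - rankDiff₂ m j)
          (rankDiff m khat - rankDiff ρ khat)) := by
  classical
  let Γ := generatorBundle n r μ
  have hmono : ∀ i, ∀ j ≥ i, ∀ x, V.derived i x ≤ V.derived j x := by
    intro i j hij
    induction j, hij using Nat.le_induction with
    | base => exact fun x => le_rfl
    | succ j _ ih => exact fun x => (ih x).trans (TangentDistribution.le_derivedOnce _ x)
  have hbot : ∀ i ≤ ℓ, ∀ x, V.derived i x ⊓ Γ x = ⊥ := fun i hi x =>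
    le_bot_iff.1 ((inf_le_inf_right _ (hmono i ℓ hi x)).trans (htrans.1 x).le)
  -- On an empty manifold ranks would carry no information; the failure of transversality at `ℓ + 1`
  -- supplies a point.
  obtain ⟨x₀⟩ : Nonempty M := by
    by_contra h
    exact htrans.2 fun x => (h ⟨x⟩).elim
  have hρ0 : ∀ i ≤ ℓ, ρ i = 0 := by
    intro i hi
    rw [← hρ i x₀]
    change Module.finrank ℝ ↥(V.derived i x₀ ⊓ Γ x₀) = 0
    rw [hbot i hi x₀, finrank_bot]
  obtain ⟨j₀, hj₀⟩ := hgen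
  -- Bracket generation makes Γ one of the intersections, so its rank is the transverse rank `ρ j₀`.
  have hΓ : Γ.HasRank (ρ j₀) := by
    intro x
    have h := hρ j₀ x
    rwa [TangentDistribution.inter, hj₀ x, top_inf_eq] at h
  have hρle : ∀ i, ρ i ≤ ρ j₀ := by
    intro i
    have : FiniteDimensional ℝ (TangentSpace (𝓡 n) x₀) :=
      inferInstanceAs (FiniteDimensional ℝ (EuclideanSpace ℝ (Fin n)))
    rw [← hρ i x₀, ← hΓ x₀]
    exact Submodule.finrank_mono inf_le_right
  -- The subtraction never truncates, as `ρ i ≤ ρ j₀`.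
  let d : ℕ → ℕ := fun i => m i + ρ j₀ - ρ i
  have hd : ∀ i, ((V.derived i).sum Γ).HasRank (d i) := fun i => (hm i).sum hΓ (hρ i)
  have hloc : V.HasLocalSections := fun x v hv => hV.2 x v hv
  have hder := hμ.derived_sum_generatorBundle hinv hloc hd
  have hstable : (V.sum Γ).derived k = (V.sum Γ).derived (k + 1) := by
    rw [hder, hder, ← hlen.1]
  have hex : ∃ j, (V.sum Γ).derived j = (V.sum Γ).derived (j + 1) := ⟨k, hstable⟩
  have hlenhat : (V.sum Γ).HasDerivedLength (Nat.find hex) :=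
    ⟨Nat.find_spec hex, fun j hj => Nat.find_min' hex hj⟩
  have hm01 : m 0 ≠ m 1 := by
    intro h
    have h0 : V.derived 0 = V.derived (0 + 1) := by
      funext x
      have : FiniteDimensional ℝ (TangentSpace (𝓡 n) x) :=
        inferInstanceAs (FiniteDimensional ℝ (EuclideanSpace ℝ (Fin n)))
      exact Submodule.eq_of_le_of_finrank_eq (hmono 0 1 zero_le_one x)
        ((hm 0 x).trans (h.trans (hm 1 x).symm))
    have := hlen.2 h0
    omega
  have hpos : 1 ≤ Nat.find hex := by
    rw [Nat.one_le_iff_ne_zero, Ne, Nat.find_eq_zero]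
    intro h
    rw [hder, hder] at h
    have h1 : d 0 = d 1 := by rw [← hd 0 x₀, ← hd 1 x₀, h]
    -- Here `ℓ ≥ 1` is essential: the transverse ranks at 0 and 1 both vanish, so `d 0 = d 1` would
    -- force `m 0 = m 1`.
    simp only [d, hρ0 0 (Nat.zero_le _), hρ0 1 hℓ] at h1
    omega
  refine ⟨fun x => disjoint_iff.2 (hbot 0 (Nat.zero_le _) x), Nat.find hex, hpos,
    Nat.find_min' hex hstable, hlenhat, ⟨⟨d 0, hd 0⟩, ?_⟩, Nat.find hex, d, hpos, hlenhat, ?_, ?_⟩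
  · exact fun x v hv => (hloc.sum hμ.hasLocalSections_generatorBundle) x hv
  · exact fun j => hder j ▸ hd j
  · have hdcast : ∀ i, (d i : ℤ) = m i + ρ j₀ - ρ i := fun i => by
      have := hρle i
      simp only [d]
      omega
    have hdiff : ∀ i, rankDiff d i = rankDiff m i - rankDiff ρ i := fun i => by
      simp only [rankDiff, hdcast]
      ring
    have hdiff₂ : ∀ i, -rankDiff₂ d i = rankDiff₂ ρ i - rankDiff₂ m i := fun i => by
      simp only [rankDiff₂, hdiff]
      ring
    simp only [hdiff, hdiff₂]
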